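/- An election consists of a finite set $\mathcal{C}$ of $m$ candidates, a finite nonempty set $\mathcal{V}$ of $n$ voters and, for each voter $v$, a bijective ranking $r_v : \mathcal{C} \to \{1, \dots, m\}$ (rank $1$ is the most preferred). The $1$-Borda score of a nonempty committee $T \subseteq \mathcal{C}$ is $$r_{\mathcal{V}}(T) = \frac{1}{n} \sum_{v \in \mathcal{V}} \min_{c \in T} r_v(c).$$ Greedy starts with $T_0 = \varnothing$ and, in iteration $j$, picks a candidate $c_j \in \mathcal{C} \setminus T_{j-1}$ that minimizes $r_{\mathcal{V}}(T_{j-1} \cup \{c_j\})$ and sets $T_j = T_{j-1} \cup \{c_j\}$; it outputs $T_k$ as its committee of size $k$. **Theorem.** There exist an election with $m$ candidates and an integer $k$ with $1 \le k \le m$ such that, however Greedy breaks ties, its committee $T_k$ satisfies $$r_{\mathcal{V}}(T_k) > 1.962 \cdot \frac{m+1}{k+1}.$$ -/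

import Mathlib

/-- An election with voter set `V` and candidate set `C`: every voter `v` has a bijective ranking
function `rank v : C → {1, …, m}`, `m = |C|`; smaller ranks are preferred. -/
structure Election (V C : Type) [Fintype C] where
  rank : V → C → ℕ
  rank_bijOn : ∀ v, Set.BijOn (rank v) Set.univ (Set.Icc 1 (Fintype.card C))

namespace Election

variable {V C : Type} [Fintype C]

/-- The cost `min_{c ∈ T} rank v c` of a nonempty committee `T` for the voter `v`
(the least element of a nonempty set of natural numbers; the value at `T = ∅` is never used). -/
noncomputable def cost (E : Election V C) (v : V) (T : Finset C) : ℕ :=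
  sInf (E.rank v '' (T : Set C))

/-- The `1`-Borda score of a committee: the average over the voters of the cost. -/
noncomputable def score [Fintype V] (E : Election V C) (T : Finset C) : ℝ :=
  (∑ v, (E.cost v T : ℝ)) / (Fintype.card V : ℝ)

/-- `E.IsGreedyCommittee j T`: the set `T` can be the state of Greedy after `j` iterations.
Greedy starts from `∅`; each iteration adds a candidate, among those not yet chosen, whose
addition minimizes the score. Ties may be broken in any way. -/
inductive IsGreedyCommittee [Fintype V] [DecidableEq C] (E : Election V C) :
    ℕ → Finset C → Prop
  | start : IsGreedyCommittee E 0 ∅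
  | step (j : ℕ) (T : Finset C) (c : C) (hT : IsGreedyCommittee E j T) (hc : c ∉ T)
      (hmin : ∀ c' : C, c' ∉ T → E.score (insert c T) ≤ E.score (insert c' T)) :
      IsGreedyCommittee E (j + 1) (insert c T)

end Election

open Filter Topology

/-!
Many fillers, which are treated alike, let one place `k` candidates on the ballots of finitely many
voter types at positions given as fractions of the number of fillers, while the position of a filler
is uniformly distributed.

The voters are spread over levels, the cost at level `u` being `η * q ^ u`, and every residue of
`u` modulo `N` is occupied by one type. Each candidate advances the voters at the levels just past a
cursor by `N` levels and is useless for all others, so that the cost profile keeps its shape while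
the total cost scales with `y = q ^ t`, where `t` is the cursor. With `p = q ^ N`, a filler gains as
much as a drop of `y` by about `η (1 + p) y ^ 2 / 4`, so a candidate only has to make a slightly
larger drop. For `η = 4 δ / (1 + p)` this is `δ y ^ 2`, and `y` decreases as slowly as
`1 / (1 + δ k)`. The mean cost after `k` candidates is `η (1 - p) y / log (1 / p)`, which is about
`4 (1 - p) / ((1 + p) log (1 / p))` times `1 / k`. This factor increases with `p`. A candidate is
not attractive one round too early as long as `p (1 + p) < 1`, so that `p` can approach the inverse
of the golden ratio `φ`, where the factor is `4 / (φ ^ 3 log φ) = 1.9623…`.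
-/

/-- Some election and some committee size `k` are such that, however ties are broken, the score of
Greedy's committee exceeds `B` times the value `(m + 1) / (k + 1)`. -/
def GreedyExceeds (B : ℝ) : Prop :=
  ∃ (V C : Type) (_ : Fintype V) (_ : Nonempty V) (_ : Fintype C) (_ : DecidableEq C)
    (E : Election V C) (k : ℕ),
    1 ≤ k ∧ k ≤ Fintype.card C ∧
      ∀ T : Finset C, E.IsGreedyCommittee k T →
        E.score T > B * (((Fintype.card C : ℝ) + 1) / ((k : ℝ) + 1))

/-- The minimum of `a` and of the first `j` values `r 0 θ, …, r (j - 1) θ`: the cost for the voters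
of type `θ` of the committee of the first `j` candidates, where `r i θ` is the position of the
candidate `i` and `a` caps the cost of the empty committee. -/
def runningMin {Θ α : Type*} [LinearOrder α] (a : α) (r : ℕ → Θ → α) : ℕ → Θ → α
  | 0, _ => a
  | j + 1, θ => min (runningMin a r j θ) (r j θ)

namespace Election

variable {V C : Type} [Fintype C]

theorem cost_singleton (E : Election V C) (v : V) (c : C) : E.cost v {c} = E.rank v c := by
  simp [cost]

theorem cost_insert [DecidableEq C] (E : Election V C) (v : V) (c : C) {T : Finset C}
    (hT : T.Nonempty) : E.cost v (insert c T) = min (E.rank v c) (E.cost v T) := by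
  unfold cost
  rw [Finset.coe_insert, Set.image_insert_eq,
    csInf_insert (OrderBot.bddBelow _) ((Finset.coe_nonempty.2 hT).image _)]

theorem rank_le_card (E : Election V C) (v : V) (c : C) : E.rank v c ≤ Fintype.card C :=
  ((E.rank_bijOn v).mapsTo (Set.mem_univ c)).2

theorem IsGreedyCommittee.eq_of_forall_score_lt [Fintype V] [DecidableEq C] {E : Election V C}
    {k : ℕ} {T : ℕ → Finset C} (hzero : T 0 = ∅)
    (hsucc : ∀ j < k, ∃ c ∉ T j, T (j + 1) = insert c (T j) ∧
      ∀ c' ∉ T j, c' ≠ c → E.score (insert c (T j)) < E.score (insert c' (T j)))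
    {j : ℕ} {S : Finset C} (hS : E.IsGreedyCommittee j S) (hj : j ≤ k) : S = T j := by
  induction hS with
  | start => exact hzero.symm
  | step j S c hS hc hmin ih =>
    obtain rfl := ih (Nat.le_of_succ_le hj)
    obtain ⟨d, hd, hTd, hlt⟩ := hsucc j hj
    by_cases hcd : c = d
    · rw [hTd, hcd]
    · exact absurd (hmin d hd) (not_le.2 (hlt c hc hcd))

end Election

/-! ### Elections with many fillers -/

theorem exists_bijOn_Icc_extending {α β : Type*} [Fintype α] [Fintype β] {f : α → ℕ}
    (hinj : Function.Injective f)
    (hmem : ∀ a, f a ∈ Set.Icc 1 (Fintype.card α + Fintype.card β)) :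
    ∃ g : α ⊕ β → ℕ, Set.BijOn g Set.univ (Set.Icc 1 (Fintype.card α + Fintype.card β)) ∧
      ∀ a, g (Sum.inl a) = f a := by
  have hmaps : (Set.range (Sum.inl : α → α ⊕ β)).MapsTo (Sum.elim f 0)
      (Finset.Icc 1 (Fintype.card α + Fintype.card β)) := by
    rintro _ ⟨a, rfl⟩
    simpa using hmem a
  have hinjOn : (Set.range (Sum.inl : α → α ⊕ β)).InjOn (Sum.elim f 0) := by
    rintro _ ⟨a, rfl⟩ _ ⟨b, rfl⟩ hab
    exact congrArg _ (hinj hab)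
  obtain ⟨e, he⟩ := hmaps.exists_equiv_extend_of_card_eq (by simp) hinjOn
  refine ⟨fun c => e c, ⟨fun c _ => Finset.mem_Icc.1 (e c).2,
    (Subtype.val_injective.comp e.injective).injOn, fun y hy => ?_⟩,
    fun a => he _ (Set.mem_range_self a)⟩
  exact ⟨e.symm ⟨y, Finset.mem_Icc.2 hy⟩, Set.mem_univ _, by simp⟩

theorem two_mul_sum_tsub_le_of_injective {ι : Type*} [Fintype ι] {p : ι → ℕ}
    (hp : Function.Injective p) (x : ℕ) : 2 * ∑ i, (x - p i) ≤ x * (x + 1) := by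
  classical
  calc 2 * ∑ i, (x - p i)
      = 2 * ∑ a ∈ Finset.univ.image p, (x - a) := by
        rw [Finset.sum_image (f := fun a => x - a) hp.injOn]
    _ ≤ 2 * ∑ a ∈ Finset.range (x + 1), (x - a) := by
        gcongr 2 * ?_
        refine Finset.sum_le_sum_of_ne_zero fun a _ ha => Finset.mem_range.2 ?_
        omega
    _ = (∑ a ∈ Finset.range (x + 1), a) * 2 := by
        rw [mul_comm]
        congr 1
        simpa using Finset.sum_range_reflect (fun a => a) (x + 1)
    _ = x * (x + 1) := by rw [Finset.sum_range_id_mul_two, Nat.add_sub_cancel, mul_comm]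

/-- A lower bound for the average of `min x r` over the ranks `r` of `n` fillers: as these ranks are
distinct, the fillers save in total at most `x + (x - 1) + ⋯ + 1` for a voter whose current cost
is `x`. -/
noncomputable def fillerCost (n x : ℕ) : ℝ := x - x * (x + 1) / (2 * n)

theorem fillerCost_mul_card_le {ι : Type*} [Fintype ι] [Nonempty ι] {p : ι → ℕ}
    (hp : Function.Injective p) (x : ℕ) :
    fillerCost (Fintype.card ι) x * Fintype.card ι ≤ ∑ i, ((min x (p i) : ℕ) : ℝ) := by
  have : (0 : ℝ) < Fintype.card ι := Nat.cast_pos.2 Fintype.card_pos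
  have hsplit : ∑ i, min x (p i) + ∑ i, (x - p i) = Fintype.card ι * x := by
    rw [← Finset.sum_add_distrib, Finset.sum_congr rfl fun i _ => show _ = x by omega,
      Finset.sum_const, Finset.card_univ, smul_eq_mul]
  have hsaved := two_mul_sum_tsub_le_of_injective hp x
  have hbound : (2 * (Fintype.card ι * x) : ℝ) ≤
      2 * ∑ i, ((min x (p i) : ℕ) : ℝ) + x * (x + 1) := by
    have : 2 * (Fintype.card ι * x) ≤ 2 * ∑ i, min x (p i) + x * (x + 1) := by omega
    exact_mod_cast this
  have hscale : fillerCost (Fintype.card ι) x * Fintype.card ι =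
      Fintype.card ι * x - x * (x + 1) / 2 := by
    unfold fillerCost
    field_simp
  linarith

/-- The candidates are those of `α` and the elements of a group `G`, the fillers. For every type
`θ`, with ballot `g θ`, and every element of `G` there is a voter whose ballot is `g θ` with the
fillers translated by that element, so that no filler is distinguished from another. -/
def translateElection {Θ α G : Type} [Fintype α] [Fintype G] [AddGroup G] (g : Θ → α ⊕ G → ℕ)
    (hg : ∀ θ, Set.BijOn (g θ) Set.univ (Set.Icc 1 (Fintype.card α + Fintype.card G))) :
    Election (Θ × G) (α ⊕ G) where
  rank v c := g v.1 (Sum.map id (v.2 + ·) c)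
  rank_bijOn v := by
    have hbij : Function.Bijective (Sum.map id (v.2 + ·) : α ⊕ G → α ⊕ G) :=
      (Equiv.sumCongr (Equiv.refl α) (Equiv.addLeft v.2)).bijective
    rw [Fintype.card_sum]
    exact (hg v.1).comp hbij.bijOn_univ

/-- The committee of the first `j` of the `k` candidates that are not fillers. -/
def initialCommittee (k : ℕ) (G : Type*) (j : ℕ) : Finset (Fin k ⊕ G) :=
  (Finset.univ.filter fun i : Fin k => (i : ℕ) < j).map Function.Embedding.inl

section InitialCommittee

variable {k : ℕ} {G : Type*} {j : ℕ}

theorem initialCommittee_zero : initialCommittee k G 0 = ∅ := by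
  simp [initialCommittee]

theorem inl_mem_initialCommittee {i : Fin k} :
    Sum.inl i ∈ initialCommittee k G j ↔ (i : ℕ) < j := by
  simp [initialCommittee]

theorem initialCommittee_succ [DecidableEq G] (hj : j < k) :
    initialCommittee k G (j + 1) = insert (Sum.inl ⟨j, hj⟩) (initialCommittee k G j) := by
  ext (i | d)
  · simp only [inl_mem_initialCommittee, Finset.mem_insert, Sum.inl.injEq, Fin.ext_iff]
    omega
  · simp [initialCommittee]

end InitialCommittee

section TranslateElection

variable {Θ G : Type} {k : ℕ} [Fintype G] [AddGroup G] {g : Θ → Fin k ⊕ G → ℕ}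
  (hg : ∀ θ, Set.BijOn (g θ) Set.univ
    (Set.Icc 1 (Fintype.card (Fin k) + Fintype.card G)))
  {pos : ℕ → Θ → ℕ} (hpos : ∀ θ (i : Fin k), g θ (Sum.inl i) = pos i θ)

include hpos

theorem translateElection_cost_insert [DecidableEq G] {j : ℕ} (hj : j ≤ k) (v : Θ × G)
    (c : Fin k ⊕ G) :
    (translateElection g hg).cost v (insert c (initialCommittee k G j)) =
      min (runningMin (k + Fintype.card G) pos j v.1) (g v.1 (Sum.map id (v.2 + ·) c)) := by
  induction j generalizing c with
  | zero =>
    have hrank := (translateElection g hg).rank_le_card v c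
    rw [Fintype.card_sum, Fintype.card_fin] at hrank
    rw [initialCommittee_zero, insert_empty_eq, Election.cost_singleton]
    exact (min_eq_right hrank).symm
  | succ j ih =>
    rw [initialCommittee_succ hj, Election.cost_insert _ _ _ (Finset.insert_nonempty _ _),
      ih (Nat.le_of_succ_le hj), min_comm]
    simp only [Sum.map_inl, id, hpos]
    rfl

variable [Fintype Θ]

theorem translateElection_score_inl [DecidableEq G] {j : ℕ} (hj : j ≤ k) (l : Fin k) :
    (translateElection g hg).score (insert (Sum.inl l) (initialCommittee k G j)) =
      (∑ θ, min (runningMin (k + Fintype.card G) pos j θ) (pos l θ) : ℕ) /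
        (Fintype.card Θ : ℝ) := by
  have hG : (Fintype.card G : ℝ) ≠ 0 := Nat.cast_ne_zero.2 Fintype.card_ne_zero
  unfold Election.score
  simp only [translateElection_cost_insert hg hpos hj, Sum.map_inl, id, hpos,
    Fintype.sum_prod_type, Finset.sum_const, Finset.card_univ, Fintype.card_prod, nsmul_eq_mul,
    ← Finset.mul_sum, Nat.cast_mul, Nat.cast_sum]
  rw [mul_comm, mul_div_mul_right _ _ hG]

theorem translateElection_score_initialCommittee_succ {j : ℕ} (hj : j < k) :
    (translateElection g hg).score (initialCommittee k G (j + 1)) =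
      (∑ θ, runningMin (k + Fintype.card G) pos (j + 1) θ : ℕ) / (Fintype.card Θ : ℝ) := by
  classical
  rw [initialCommittee_succ hj, translateElection_score_inl hg hpos hj.le]
  rfl

theorem le_translateElection_score_inr [DecidableEq G] {j : ℕ} (hj : j ≤ k) (d : G) :
    (∑ θ, fillerCost (Fintype.card G) (runningMin (k + Fintype.card G) pos j θ)) /
        Fintype.card Θ ≤
      (translateElection g hg).score (insert (Sum.inr d) (initialCommittee k G j)) := by
  have hG : (0 : ℝ) < Fintype.card G := Nat.cast_pos.2 Fintype.card_pos
  unfold Election.score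
  simp only [translateElection_cost_insert hg hpos hj, Sum.map_inr, Fintype.sum_prod_type,
    Fintype.card_prod, Nat.cast_mul]
  rw [mul_comm (Fintype.card Θ : ℝ), ← div_div]
  gcongr
  rw [le_div_iff₀ hG, Finset.sum_mul]
  refine Finset.sum_le_sum fun θ _ => fillerCost_mul_card_le (fun a b hab => ?_) _
  simpa using (hg θ).injOn (Set.mem_univ _) (Set.mem_univ _) hab

theorem eq_initialCommittee_of_isGreedyCommittee [DecidableEq G] [Nonempty Θ]
    (hmain : ∀ l < k, ∀ j < l, ∑ θ, runningMin (k + Fintype.card G) pos (j + 1) θ <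
      ∑ θ, min (runningMin (k + Fintype.card G) pos j θ) (pos l θ))
    (hfiller : ∀ j < k, ((∑ θ, runningMin (k + Fintype.card G) pos (j + 1) θ : ℕ) : ℝ) <
      ∑ θ, fillerCost (Fintype.card G) (runningMin (k + Fintype.card G) pos j θ))
    {T : Finset (Fin k ⊕ G)} (hT : (translateElection g hg).IsGreedyCommittee k T) :
    T = initialCommittee k G k := by
  have : (0 : ℝ) < Fintype.card Θ := Nat.cast_pos.2 Fintype.card_pos
  refine hT.eq_of_forall_score_lt initialCommittee_zero (fun j hj => ?_) le_rfl
  refine ⟨Sum.inl ⟨j, hj⟩, by simp [inl_mem_initialCommittee], initialCommittee_succ hj, ?_⟩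
  rw [← initialCommittee_succ hj, translateElection_score_initialCommittee_succ hg hpos hj]
  rintro (l | d) hmem hne
  · have hjl : j < l := by
      simp only [inl_mem_initialCommittee, ne_eq, Sum.inl.injEq, Fin.ext_iff] at hmem hne
      omega
    rw [translateElection_score_inl hg hpos hj.le l]
    have := hmain l l.2 j hjl
    gcongr
  · refine lt_of_lt_of_le ?_ (le_translateElection_score_inr hg hpos hj.le d)
    have := hfiller j hj
    gcongr

end TranslateElection

/-! ### The limit of infinitely many fillers -/

/-- The ranks among `k + n` candidates of candidates at the positions `r`, given as fractions of
the `n` fillers. The summand `i` keeps the ranks of candidates at equal positions apart. -/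
noncomputable def discretize {Θ : Type*} (n : ℕ) (r : ℕ → Θ → ℝ) (i : ℕ) (θ : Θ) : ℕ :=
  ⌊r i θ * n⌋₊ + i + 1

section Discretize

variable {Θ : Type*} {r : ℕ → Θ → ℝ}

theorem tendsto_discretize_div {i : ℕ} {θ : Θ} (hr : 0 ≤ r i θ) :
    Tendsto (fun n : ℕ => (discretize n r i θ : ℝ) / n) atTop (𝓝 (r i θ)) := by
  have hfloor := (tendsto_nat_floor_mul_div_atTop hr).comp (tendsto_natCast_atTop_atTop (R := ℝ))
  have hsum := hfloor.add (tendsto_const_div_atTop_nhds_zero_nat ((i : ℝ) + 1))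
  rw [add_zero] at hsum
  refine hsum.congr fun n => ?_
  simp [discretize, add_div, add_assoc]

theorem tendsto_runningMin_discretize_div {j : ℕ} {θ : Θ} (hr : ∀ i < j, 0 ≤ r i θ) (k : ℕ) :
    Tendsto (fun n : ℕ => ((runningMin (k + n) (discretize n r) j θ : ℕ) : ℝ) / n) atTop
      (𝓝 (runningMin 1 r j θ)) := by
  induction j with
  | zero =>
    have hcap := (tendsto_const_div_atTop_nhds_zero_nat (k : ℝ)).add_const 1
    rw [zero_add] at hcap
    refine hcap.congr' ?_
    filter_upwards [eventually_ne_atTop 0] with n hn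
    have : (n : ℝ) ≠ 0 := Nat.cast_ne_zero.2 hn
    simp only [runningMin, Nat.cast_add]
    field_simp
  | succ j ih =>
    have hmin := (ih fun i hi => hr i (hi.trans j.lt_succ_self)).min
      (tendsto_discretize_div (hr j j.lt_succ_self))
    refine hmin.congr fun n => ?_
    simp only [runningMin, Nat.cast_min]
    exact min_div_div_right (Nat.cast_nonneg n) _ _

theorem eventually_discretize_ne {i j : ℕ} {θ : Θ} (hi : 0 ≤ r i θ) (hj : 0 ≤ r j θ)
    (hij : i ≠ j) : ∀ᶠ n : ℕ in atTop, discretize n r i θ ≠ discretize n r j θ := by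
  by_cases heq : r i θ = r j θ
  · refine Eventually.of_forall fun n => ?_
    simpa [discretize, heq] using hij
  · have hsub := ((tendsto_discretize_div hi).sub (tendsto_discretize_div hj)).eventually_ne
      (sub_ne_zero.2 heq)
    filter_upwards [hsub] with n hn hn'
    exact hn (by rw [hn', sub_self])

theorem discretize_mem_Icc {k n i : ℕ} {θ : Θ} (hi : i < k) (hr : r i θ ≤ 1) :
    discretize n r i θ ∈ Set.Icc 1 (k + n) := by
  have hfloor : ⌊r i θ * n⌋₊ ≤ n :=
    Nat.floor_le_of_le (mul_le_of_le_one_left (Nat.cast_nonneg n) hr)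
  simp only [discretize, Set.mem_Icc]
  omega

end Discretize

theorem eventually_forall_lt {α : Type*} {l : Filter α} {P : ℕ → α → Prop} {k : ℕ}
    (h : ∀ i < k, ∀ᶠ x in l, P i x) : ∀ᶠ x in l, ∀ i < k, P i x :=
  (eventually_all_finite (Set.finite_lt_nat k)).2 h

theorem eventually_lt_of_tendsto_div {f g : ℕ → ℝ} {a b : ℝ}
    (hf : Tendsto (fun n => f n / n) atTop (𝓝 a)) (hg : Tendsto (fun n => g n / n) atTop (𝓝 b))
    (hab : a < b) : ∀ᶠ n in atTop, f n < g n := by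
  filter_upwards [hf.eventually_lt hg hab, eventually_gt_atTop 0] with n hn hpos
  exact (div_lt_div_iff_of_pos_right (Nat.cast_pos.2 hpos)).1 hn

theorem tendsto_fillerCost_div {x : ℕ → ℕ} {a : ℝ}
    (hx : Tendsto (fun n => (x n : ℝ) / n) atTop (𝓝 a)) :
    Tendsto (fun n => fillerCost n (x n) / n) atTop (𝓝 (a - a ^ 2 / 2)) := by
  have hlim := hx.sub ((hx.mul (hx.add tendsto_inv_atTop_nhds_zero_nat)).div_const 2)
  rw [add_zero, ← sq] at hlim
  refine hlim.congr' ?_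
  filter_upwards [eventually_ne_atTop 0] with n hn
  have : (n : ℝ) ≠ 0 := Nat.cast_ne_zero.2 hn
  unfold fillerCost
  field_simp

/-- With voter types `Θ` and `k` candidates at the positions `r`, given as fractions of an infinite
list of fillers, Greedy picks the candidates in the order of their indices: each of them is better
than the later ones and, as a filler is uniformly distributed on `[0, 1]`, than the fillers. -/
structure IsGreedyOrder {Θ : Type*} [Fintype Θ] (r : ℕ → Θ → ℝ) (k : ℕ) : Prop where
  mem_Icc : ∀ i < k, ∀ θ, r i θ ∈ Set.Icc 0 1
  sum_lt_later : ∀ l < k, ∀ j < l,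
    ∑ θ, runningMin 1 r (j + 1) θ < ∑ θ, min (runningMin 1 r j θ) (r l θ)
  sum_lt_filler : ∀ j < k,
    ∑ θ, runningMin 1 r (j + 1) θ < ∑ θ, (runningMin 1 r j θ - runningMin 1 r j θ ^ 2 / 2)

namespace IsGreedyOrder

variable {Θ : Type*} [Fintype Θ] {r : ℕ → Θ → ℝ} {k : ℕ}

theorem tendsto_runningMin (h : IsGreedyOrder r k) {j : ℕ} (hj : j ≤ k) (θ : Θ) :
    Tendsto (fun n : ℕ => ((runningMin (k + n) (discretize n r) j θ : ℕ) : ℝ) / n) atTop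
      (𝓝 (runningMin 1 r j θ)) :=
  tendsto_runningMin_discretize_div (fun i hi => (h.mem_Icc i (hi.trans_le hj) θ).1) k

theorem tendsto_sum_runningMin (h : IsGreedyOrder r k) {j : ℕ} (hj : j ≤ k) :
    Tendsto (fun n : ℕ => ((∑ θ, runningMin (k + n) (discretize n r) j θ : ℕ) : ℝ) / n) atTop
      (𝓝 (∑ θ, runningMin 1 r j θ)) := by
  simp only [Nat.cast_sum, Finset.sum_div]
  exact tendsto_finsetSum _ fun θ _ => h.tendsto_runningMin hj θ

theorem eventually_sum_lt_later (h : IsGreedyOrder r k) :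
    ∀ᶠ n : ℕ in atTop, ∀ l < k, ∀ j < l,
      ∑ θ, runningMin (k + n) (discretize n r) (j + 1) θ <
        ∑ θ, min (runningMin (k + n) (discretize n r) j θ) (discretize n r l θ) := by
  refine eventually_forall_lt fun l hl => eventually_forall_lt fun j hj => ?_
  have hlater : Tendsto (fun n : ℕ => ((∑ θ, min (runningMin (k + n) (discretize n r) j θ)
      (discretize n r l θ) : ℕ) : ℝ) / n) atTop (𝓝 (∑ θ, min (runningMin 1 r j θ) (r l θ))) := by
    simp only [Nat.cast_sum, Finset.sum_div, Nat.cast_min,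
      ← min_div_div_right (Nat.cast_nonneg (α := ℝ) _)]
    exact tendsto_finsetSum _ fun θ _ => (h.tendsto_runningMin (hj.trans hl).le θ).min
      (tendsto_discretize_div (h.mem_Icc l hl θ).1)
  filter_upwards [eventually_lt_of_tendsto_div (h.tendsto_sum_runningMin (hj.trans hl)) hlater
    (h.sum_lt_later l hl j hj)] with n hn
  exact_mod_cast hn

theorem eventually_sum_lt_filler (h : IsGreedyOrder r k) :
    ∀ᶠ n : ℕ in atTop, ∀ j < k,
      ((∑ θ, runningMin (k + n) (discretize n r) (j + 1) θ : ℕ) : ℝ) <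
        ∑ θ, fillerCost n (runningMin (k + n) (discretize n r) j θ) := by
  refine eventually_forall_lt fun j hj => ?_
  refine eventually_lt_of_tendsto_div (h.tendsto_sum_runningMin hj) ?_ (h.sum_lt_filler j hj)
  simp only [Finset.sum_div]
  exact tendsto_finsetSum _ fun θ _ => tendsto_fillerCost_div (h.tendsto_runningMin hj.le θ)

theorem eventually_injective_discretize (h : IsGreedyOrder r k) :
    ∀ᶠ n : ℕ in atTop, ∀ θ, Function.Injective fun i : Fin k => discretize n r i θ := by
  have hne : ∀ᶠ n : ℕ in atTop, ∀ θ, ∀ i < k, ∀ j < k, i ≠ j →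
      discretize n r i θ ≠ discretize n r j θ := by
    refine eventually_all.2 fun θ => eventually_forall_lt fun i hi =>
      eventually_forall_lt fun j hj => eventually_imp_distrib_left.2 fun hij => ?_
    exact eventually_discretize_ne (h.mem_Icc i hi θ).1 (h.mem_Icc j hj θ).1 hij
  filter_upwards [hne] with n hn θ i j hij
  by_contra hij'
  exact hn θ i i.2 j j.2 (Fin.val_ne_of_ne hij') hij

theorem eventually_lt_score (h : IsGreedyOrder r k) {B : ℝ}
    (hB : B < (k + 1) * ((∑ θ, runningMin 1 r k θ) / Fintype.card Θ)) :
    ∀ᶠ n : ℕ in atTop, B * (((k : ℝ) + n + 1) / (k + 1)) <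
      (∑ θ, runningMin (k + n) (discretize n r) k θ : ℕ) / (Fintype.card Θ : ℝ) := by
  refine eventually_lt_of_tendsto_div (a := B / (k + 1)) ?_
    (((h.tendsto_sum_runningMin le_rfl).div_const (Fintype.card Θ : ℝ)).congr fun n => ?_) ?_
  · have hlim := (((tendsto_const_div_atTop_nhds_zero_nat ((k : ℝ) + 1)).add_const 1).const_mul
      (B / (k + 1)))
    rw [zero_add, mul_one] at hlim
    refine hlim.congr' ?_
    filter_upwards [eventually_ne_atTop 0] with n hn
    have : (n : ℝ) ≠ 0 := Nat.cast_ne_zero.2 hn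
    field_simp
    ring
  · exact div_right_comm _ _ _
  · rw [div_lt_iff₀ (by positivity), mul_comm]
    exact hB

theorem greedyExceeds {Θ : Type} [Fintype Θ] [Nonempty Θ] {r : ℕ → Θ → ℝ} {B : ℝ}
    (h : IsGreedyOrder r (k + 1))
    (hB : B < (k + 2) * ((∑ θ, runningMin 1 r (k + 1) θ) / Fintype.card Θ)) :
    GreedyExceeds B := by
  have hB' : B < ((k + 1 : ℕ) + 1) * ((∑ θ, runningMin 1 r (k + 1) θ) / Fintype.card Θ) := by
    convert hB using 2
    push_cast
    ring
  obtain ⟨n, hn, hinj, hlater, hfiller, hscore⟩ :=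
    ((eventually_ne_atTop 0).and (h.eventually_injective_discretize.and
      (h.eventually_sum_lt_later.and (h.eventually_sum_lt_filler.and
        (h.eventually_lt_score hB'))))).exists
  have : NeZero n := ⟨hn⟩
  have hballot : ∀ θ, ∃ g : Fin (k + 1) ⊕ Fin n → ℕ,
      Set.BijOn g Set.univ (Set.Icc 1 (Fintype.card (Fin (k + 1)) + Fintype.card (Fin n))) ∧
        ∀ i : Fin (k + 1), g (Sum.inl i) = discretize n r i θ := fun θ =>
    exists_bijOn_Icc_extending (hinj θ) fun i => by
      simpa using discretize_mem_Icc i.2 (h.mem_Icc i i.2 θ).2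
  choose g hg hpos using hballot
  refine ⟨Θ × Fin n, Fin (k + 1) ⊕ Fin n, inferInstance, inferInstance, inferInstance,
    inferInstance, translateElection g hg, k + 1, k.succ_pos, by simp, fun T hT => ?_⟩
  rw [eq_initialCommittee_of_isGreedyCommittee hg hpos (by simpa using hlater)
      (by simpa using hfiller) hT,
    translateElection_score_initialCommittee_succ hg hpos k.lt_succ_self]
  simpa using hscore

end IsGreedyOrder

/-! ### Advancing voters along geometric levels -/

/-- The first `u ≥ t` with `u ≡ θ` modulo `N`. -/
def nextVisit {N : ℕ} (t : ℕ) (θ : Fin N) : ℕ := θ + N * ((t + N - 1 - θ) / N)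

section NextVisit

variable {N t t' : ℕ}

theorem nextVisit_mod (t : ℕ) (θ : Fin N) : nextVisit t θ % N = θ := by
  rw [nextVisit, Nat.add_mul_mod_self_left, Nat.mod_eq_of_lt θ.2]

theorem nextVisit_mem_Ico (t : ℕ) (θ : Fin N) : nextVisit t θ ∈ Finset.Ico t (t + N) := by
  have hθ := θ.2
  have hdiv := Nat.div_add_mod (t + N - 1 - θ) N
  have hmod := Nat.mod_lt (t + N - 1 - θ) θ.pos
  rw [nextVisit, Finset.mem_Ico]
  omega

theorem nextVisit_eq {θ : Fin N} {u : ℕ} (hu : u ∈ Finset.Ico t (t + N)) (hmod : u % N = θ) :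
    nextVisit t θ = u :=
  Nat.mod_injOn_Ico t N (nextVisit_mem_Ico t θ) hu ((nextVisit_mod t θ).trans hmod.symm)

theorem nextVisit_zero (θ : Fin N) : nextVisit 0 θ = θ :=
  nextVisit_eq (by simp) (Nat.mod_eq_of_lt θ.2)

theorem nextVisit_eq_ite (h : t ≤ t') (h' : t' ≤ t + N) (θ : Fin N) :
    nextVisit t' θ = if nextVisit t θ < t' then nextVisit t θ + N else nextVisit t θ := by
  have hmem := Finset.mem_Ico.1 (nextVisit_mem_Ico t θ)
  split_ifs with hlt
  · exact nextVisit_eq (Finset.mem_Ico.2 (by omega))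
      (by rw [Nat.add_mod_right, nextVisit_mod])
  · exact nextVisit_eq (Finset.mem_Ico.2 (by omega)) (nextVisit_mod t θ)

theorem exists_nextVisit_eq_add_mul (h : t ≤ t') (θ : Fin N) :
    ∃ m, nextVisit t' θ = nextVisit t θ + N * m := by
  obtain ⟨m, hm⟩ := Nat.exists_eq_add_of_le
    (Nat.div_le_div_right (c := N) (show t + N - 1 - θ ≤ t' + N - 1 - θ by omega))
  exact ⟨m, by rw [nextVisit, nextVisit, hm, mul_add, add_assoc]⟩

theorem sum_nextVisit {M : Type*} [AddCommMonoid M] (t : ℕ) (F : ℕ → M) :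
    ∑ θ : Fin N, F (nextVisit t θ) = ∑ u ∈ Finset.Ico t (t + N), F u := by
  refine Finset.sum_nbij (nextVisit t) (fun θ _ => nextVisit_mem_Ico t θ)
    (fun a _ b _ hab => Fin.ext ?_) (fun u hu => ?_) fun _ _ => rfl
  · rw [← nextVisit_mod t a, hab, nextVisit_mod]
  · have hu' := Finset.mem_Ico.1 hu
    exact ⟨⟨u % N, Nat.mod_lt u (by omega)⟩, by simp, nextVisit_eq hu rfl⟩

theorem sum_nextVisit_ite {M : Type*} [AddCommMonoid M] (h : t' ≤ t + N) (F : ℕ → M) :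
    ∑ θ : Fin N, (if nextVisit t θ < t' then F (nextVisit t θ) else 0) =
      ∑ u ∈ Finset.Ico t t', F u := by
  rw [sum_nextVisit t fun u => if u < t' then F u else 0, ← Finset.sum_filter,
    Finset.Ico_filter_lt, min_eq_right h]

theorem one_sub_mul_sum_pow_nextVisit {R : Type*} [CommRing R] (q : R) (t : ℕ) :
    (1 - q) * ∑ θ : Fin N, q ^ nextVisit t θ = (1 - q ^ N) * q ^ t := by
  rw [sum_nextVisit t (q ^ ·), mul_comm, geom_sum_Ico_mul_neg q (Nat.le_add_right t N), pow_add]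
  ring

end NextVisit

/-- The positions of the candidates for the voter types `θ`, which are the residues modulo `N`. The
voters of type `θ` are at a level `u ≡ θ` modulo `N` when their cost is `η * q ^ u`. The candidate
`0` puts them at level `θ`, and the candidate `i + 1` advances by `N` levels the voters whose level
lies in `[t i, t (i + 1))`; all others have it at the bottom of their ballots. -/
noncomputable def levelPlacement (η q : ℝ) (N : ℕ) (t : ℕ → ℕ) : ℕ → Fin N → ℝ
  | 0, θ => η * q ^ (θ : ℕ)
  | i + 1, θ => if nextVisit (t i) θ < t (i + 1) then η * q ^ (nextVisit (t i) θ + N) else 1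

/-- The cursor positions `t 0, …, t k` of a `levelPlacement` whose candidates Greedy picks in order.
The candidate `i + 1` lowers the total cost by a multiple of `q ^ t i - q ^ t (i + 1)`, which
`filler_lt` compares with the gain of a filler. Taken `n` rounds too early, it would gain up to
`(1 - p ^ (n + 1)) / ((1 - p) * p ^ n)` times as much, where `p = q ^ N`; `drop_lt` makes this
unattractive for `n = 0`, and `pow_period_lt` and `drop_mul_lt` do for `n ≥ 1`. -/
structure IsSchedule (η q : ℝ) (N k : ℕ) (t : ℕ → ℕ) : Prop where
  scale_mem : η ∈ Set.Ioo 0 (1 / 2)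
  ratio_mem : q ∈ Set.Ioo 0 1
  period_pos : 0 < N
  pow_period_lt : q ^ N * (1 + q ^ N) < 1
  zero : t 0 = 0
  monotone : Monotone t
  two_mul_le : ∀ i < k, 2 * t (i + 1) ≤ 2 * t i + N
  filler_lt : ∀ i < k, η * (1 + q ^ N) * (q ^ t i) ^ 2 < 2 * (1 + q) * (q ^ t i - q ^ t (i + 1))
  drop_lt : ∀ i < k, ∀ j < i, q ^ t i - q ^ t (i + 1) < q ^ t j - q ^ t (j + 1)
  drop_mul_lt : ∀ i < k, ∀ j < i,
    q ^ N * (1 + q ^ N) * (q ^ t i - q ^ t (i + 1)) * (q ^ t j) ^ 2 <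
      (q ^ t j - q ^ t (j + 1)) * (q ^ t (i + 1)) ^ 2

namespace IsSchedule

variable {η q : ℝ} {N k : ℕ} {t : ℕ → ℕ}

theorem le_add (h : IsSchedule η q N k t) {i : ℕ} (hi : i < k) : t (i + 1) ≤ t i + N := by
  have := h.two_mul_le i hi
  omega

theorem pow_period_lt_one (h : IsSchedule η q N k t) : q ^ N < 1 :=
  pow_lt_one₀ h.ratio_mem.1.le h.ratio_mem.2 h.period_pos.ne'

theorem mul_pow_mem_Ioo (h : IsSchedule η q N k t) (u : ℕ) :
    η * q ^ u ∈ Set.Ioo 0 (1 / 2) := by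
  obtain ⟨hη, hη'⟩ := h.scale_mem
  obtain ⟨hq, hq'⟩ := h.ratio_mem
  exact ⟨by positivity, (mul_le_of_le_one_right hη.le (pow_le_one₀ hq.le hq'.le)).trans_lt hη'⟩

theorem levelPlacement_mem_Icc (h : IsSchedule η q N k t) (i : ℕ) (θ : Fin N) :
    levelPlacement η q N t i θ ∈ Set.Icc 0 1 := by
  have hlevel (u : ℕ) : η * q ^ u ∈ Set.Icc 0 1 := by
    obtain ⟨hpos, hlt⟩ := h.mul_pow_mem_Ioo u
    exact ⟨hpos.le, by linarith⟩
  cases i with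
  | zero => exact hlevel _
  | succ i =>
    simp only [levelPlacement]
    split_ifs
    · exact hlevel _
    · exact ⟨zero_le_one, le_rfl⟩

theorem runningMin_succ (h : IsSchedule η q N k t) {j : ℕ} (hj : j ≤ k) (θ : Fin N) :
    runningMin 1 (levelPlacement η q N t) (j + 1) θ = η * q ^ nextVisit (t j) θ := by
  induction j with
  | zero =>
    rw [h.zero, nextVisit_zero]
    exact min_eq_right (h.levelPlacement_mem_Icc 0 θ).2
  | succ j ih =>
    rw [runningMin, ih (Nat.le_of_succ_le hj), levelPlacement,
      nextVisit_eq_ite (h.monotone j.le_succ) (h.le_add hj)]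
    split_ifs
    · refine min_eq_right (mul_le_mul_of_nonneg_left ?_ h.scale_mem.1.le)
      exact pow_le_pow_of_le_one h.ratio_mem.1.le h.ratio_mem.2.le (Nat.le_add_right _ _)
    · exact min_eq_left (by linarith [(h.mul_pow_mem_Ioo (nextVisit (t j) θ)).2])

theorem one_sub_mul_sum_runningMin_succ (h : IsSchedule η q N k t) {j : ℕ} (hj : j ≤ k) :
    (1 - q) * ∑ θ, runningMin 1 (levelPlacement η q N t) (j + 1) θ =
      η * (1 - q ^ N) * q ^ t j := by
  simp only [h.runningMin_succ hj, ← Finset.mul_sum]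
  linear_combination η * one_sub_mul_sum_pow_nextVisit (N := N) q (t j)

theorem sum_runningMin_one_lt (h : IsSchedule η q N k t) :
    ∑ θ, runningMin 1 (levelPlacement η q N t) 1 θ < (N : ℝ) / 2 := by
  have : Nonempty (Fin N) := ⟨⟨0, h.period_pos⟩⟩
  calc ∑ θ, runningMin 1 (levelPlacement η q N t) 1 θ < ∑ _θ : Fin N, (1 / 2 : ℝ) := by
        refine Finset.sum_lt_sum_of_nonempty Finset.univ_nonempty fun θ _ => ?_
        rw [h.runningMin_succ k.zero_le]
        exact (h.mul_pow_mem_Ioo _).2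
    _ = N / 2 := by simp [div_eq_mul_inv]

theorem half_le_sum_levelPlacement_succ (h : IsSchedule η q N k t) {i : ℕ} (hi : i < k) :
    (N : ℝ) / 2 ≤ ∑ θ, levelPlacement η q N t (i + 1) θ := by
  have hge (θ : Fin N) : 1 - (if nextVisit (t i) θ < t (i + 1) then 1 else 0) ≤
      levelPlacement η q N t (i + 1) θ := by
    have := (h.levelPlacement_mem_Icc (i + 1) θ).1
    simp only [levelPlacement] at this ⊢
    split_ifs at this ⊢ <;> linarith
  have hsum := Finset.sum_le_sum fun θ (_ : θ ∈ Finset.univ) => hge θ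
  rw [Finset.sum_sub_distrib, sum_nextVisit_ite (h.le_add hi) fun _ => (1 : ℝ)] at hsum
  simp only [Finset.sum_const, Finset.card_univ, Fintype.card_fin, Nat.card_Ico, nsmul_eq_mul,
    mul_one, Nat.cast_sub (h.monotone i.le_succ)] at hsum
  have htwo : (2 * t (i + 1) : ℝ) ≤ 2 * t i + N := mod_cast h.two_mul_le i hi
  linarith

theorem drop_lt_of_rounds (h : IsSchedule η q N k t) {i j n : ℕ} (hi : i < k) (hji : j < i)
    (hn : t j + N * n ≤ t (i + 1)) :
    (1 - q ^ N * (q ^ N) ^ n) * (q ^ t i - q ^ t (i + 1)) <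
      (1 - q ^ N) * (q ^ N) ^ n * (q ^ t j - q ^ t (j + 1)) := by
  obtain ⟨hq, hq'⟩ := h.ratio_mem
  have hp1 := sub_pos.2 h.pow_period_lt_one
  rcases Nat.eq_zero_or_pos n with rfl | hn0
  · simpa using mul_lt_mul_of_pos_left (h.drop_lt i hi j hji) hp1
  · have hp : 0 < q ^ N := pow_pos hq N
    have hP : 0 < (q ^ N) ^ n := pow_pos hp n
    have hPp : (q ^ N) ^ n ≤ q ^ N := pow_le_of_le_one hp.le h.pow_period_lt_one.le hn0.ne'
    have hnext : q ^ t (i + 1) ≤ (q ^ N) ^ n * q ^ t j := by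
      rw [← pow_mul, mul_comm, ← pow_add]
      exact pow_le_pow_of_le_one hq.le hq'.le hn
    have hi0 : 0 ≤ q ^ t i - q ^ t (i + 1) :=
      sub_nonneg.2 (pow_le_pow_of_le_one hq.le hq'.le (h.monotone i.le_succ))
    have hj0 : 0 ≤ q ^ t j - q ^ t (j + 1) :=
      sub_nonneg.2 (pow_le_pow_of_le_one hq.le hq'.le (h.monotone j.le_succ))
    have hlt := h.pow_period_lt
    have hdrop := h.drop_mul_lt i hi j hji
    generalize q ^ t i - q ^ t (i + 1) = x at *
    generalize q ^ t j - q ^ t (j + 1) = z at *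
    generalize (q ^ N) ^ n = P at *
    generalize q ^ N = p at *
    have hfactor : (1 - p * P) * P ≤ (1 - p) * (p * (1 + p)) := by
      nlinarith [mul_nonneg (sub_nonneg.2 hPp) (show 0 ≤ 1 - p * (p + P) by nlinarith)]
    refine lt_of_mul_lt_mul_right ?_ (show 0 ≤ P * (q ^ t j) ^ 2 by positivity)
    calc (1 - p * P) * x * (P * (q ^ t j) ^ 2)
        = (1 - p * P) * P * (x * (q ^ t j) ^ 2) := by ring
      _ ≤ (1 - p) * (p * (1 + p)) * (x * (q ^ t j) ^ 2) := by gcongr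
      _ = (1 - p) * (p * (1 + p) * x * (q ^ t j) ^ 2) := by ring
      _ < (1 - p) * (z * (q ^ t (i + 1)) ^ 2) := by gcongr
      _ ≤ (1 - p) * (z * (P * q ^ t j) ^ 2) := by gcongr
      _ = (1 - p) * P * z * (P * (q ^ t j) ^ 2) := by ring

theorem mul_sub_min_levelPlacement_le (h : IsSchedule η q N k t) {i s n : ℕ} (hs : s ≤ t i)
    (hn : t (i + 1) ≤ s + N * (n + 1)) (θ : Fin N) :
    (q ^ N) ^ n * (η * q ^ nextVisit s θ -
        min (η * q ^ nextVisit s θ) (levelPlacement η q N t (i + 1) θ)) ≤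
      η * (1 - q ^ N * (q ^ N) ^ n) *
        if nextVisit (t i) θ < t (i + 1) then q ^ nextVisit (t i) θ else 0 := by
  obtain ⟨hq, hq'⟩ := h.ratio_mem
  have hη := h.scale_mem.1
  simp only [levelPlacement]
  split_ifs with hlt
  · obtain ⟨m, hm⟩ := exists_nextVisit_eq_add_mul hs θ
    have hs_le := (Finset.mem_Ico.1 (nextVisit_mem_Ico s θ)).1
    have hmn : m ≤ n := by
      have : N * m < N * (n + 1) := by omega
      exact Nat.lt_succ_iff.1 (lt_of_mul_lt_mul_left this N.zero_le)
    have hlevel : q ^ nextVisit s θ * (q ^ N) ^ n ≤ q ^ nextVisit (t i) θ := by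
      rw [hm, ← pow_mul, ← pow_add]
      exact pow_le_pow_of_le_one hq.le hq'.le (by gcongr)
    have hnext : q ^ (nextVisit (t i) θ + N) ≤ q ^ nextVisit s θ :=
      pow_le_pow_of_le_one hq.le hq'.le (by omega)
    rw [min_eq_right (mul_le_mul_of_nonneg_left hnext hη.le), pow_add]
    linear_combination η * hlevel
  · rw [min_eq_left (by linarith [(h.mul_pow_mem_Ioo (nextVisit s θ)).2])]
    simp

theorem one_sub_mul_sum_sub_min_le (h : IsSchedule η q N k t) {i s n : ℕ} (hi : i < k)
    (hs : s ≤ t i) (hn : t (i + 1) ≤ s + N * (n + 1)) :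
    (1 - q) * (q ^ N) ^ n * ∑ θ : Fin N, (η * q ^ nextVisit s θ -
        min (η * q ^ nextVisit s θ) (levelPlacement η q N t (i + 1) θ)) ≤
      η * (1 - q ^ N * (q ^ N) ^ n) * (q ^ t i - q ^ t (i + 1)) := by
  have hsum := Finset.sum_le_sum fun θ (_ : θ ∈ Finset.univ) =>
    h.mul_sub_min_levelPlacement_le hs hn θ
  rw [← Finset.mul_sum, ← Finset.mul_sum, sum_nextVisit_ite (h.le_add hi) (q ^ ·)] at hsum
  rw [← geom_sum_Ico_mul_neg q (h.monotone i.le_succ)]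
  have hq : 0 ≤ 1 - q := sub_nonneg.2 h.ratio_mem.2.le
  linear_combination (1 - q) * hsum

theorem sum_runningMin_lt_later (h : IsSchedule η q N k t) {i j : ℕ} (hi : i < k)
    (hji : j < i) :
    ∑ θ, runningMin 1 (levelPlacement η q N t) (j + 2) θ <
      ∑ θ, min (runningMin 1 (levelPlacement η q N t) (j + 1) θ)
        (levelPlacement η q N t (i + 1) θ) := by
  have hjk : j < k := hji.trans hi
  have hdiv := Nat.div_add_mod (t (i + 1) - t j) N
  have hmod := Nat.mod_lt (t (i + 1) - t j) h.period_pos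
  have hmono := h.monotone (show j ≤ i + 1 by omega)
  set n := (t (i + 1) - t j) / N
  have hgain := h.one_sub_mul_sum_sub_min_le (n := n) hi (h.monotone hji.le)
    (by rw [mul_add_one]; omega)
  have hdrop := h.drop_lt_of_rounds (n := n) hi hji (by omega)
  have hcur := h.one_sub_mul_sum_runningMin_succ hjk.le
  have hnext := h.one_sub_mul_sum_runningMin_succ (Nat.succ_le_of_lt hjk)
  simp only [← h.runningMin_succ hjk.le, Finset.sum_sub_distrib] at hgain
  have hP : 0 < (q ^ N) ^ n := pow_pos (pow_pos h.ratio_mem.1 N) n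
  have hscale : 0 < (1 - q) * (q ^ N) ^ n := mul_pos (sub_pos.2 h.ratio_mem.2) hP
  have hη := h.scale_mem.1
  refine lt_of_mul_lt_mul_left ?_ hscale.le
  linear_combination hgain + η * hdrop + (q ^ N) ^ n * (hnext - hcur)

theorem sum_runningMin_lt_filler (h : IsSchedule η q N k t) {j : ℕ} (hj : j < k) :
    ∑ θ, runningMin 1 (levelPlacement η q N t) (j + 2) θ <
      ∑ θ, (runningMin 1 (levelPlacement η q N t) (j + 1) θ -
        runningMin 1 (levelPlacement η q N t) (j + 1) θ ^ 2 / 2) := by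
  obtain ⟨hq, hq'⟩ := h.ratio_mem
  have hη := h.scale_mem.1
  have hp1 := sub_pos.2 h.pow_period_lt_one
  have hcur := h.one_sub_mul_sum_runningMin_succ hj.le
  have hnext := h.one_sub_mul_sum_runningMin_succ (Nat.succ_le_of_lt hj)
  have hsq : (1 - q ^ 2) * ∑ θ, runningMin 1 (levelPlacement η q N t) (j + 1) θ ^ 2 =
      η ^ 2 * (1 - (q ^ N) ^ 2) * (q ^ t j) ^ 2 := by
    have hgeom := one_sub_mul_sum_pow_nextVisit (N := N) (q ^ 2) (t j)
    simp only [h.runningMin_succ hj.le, mul_pow, ← Finset.mul_sum]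
    simp only [← pow_mul, mul_comm 2] at hgeom ⊢
    linear_combination η ^ 2 * hgeom
  have hfiller := mul_lt_mul_of_pos_left (h.filler_lt j hj) (mul_pos hη hp1)
  have hscale : 0 < 1 - q ^ 2 := by nlinarith
  rw [Finset.sum_sub_distrib, ← Finset.sum_div]
  refine lt_of_mul_lt_mul_left ?_ hscale.le
  linear_combination (1 + q) * (hnext - hcur) + hsq / 2 + hfiller / 2

theorem isGreedyOrder (h : IsSchedule η q N k t) :
    IsGreedyOrder (levelPlacement η q N t) (k + 1) where
  mem_Icc i _ θ := h.levelPlacement_mem_Icc i θ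
  sum_lt_later l hl j hjl := by
    obtain ⟨i, rfl⟩ := Nat.exists_eq_add_one_of_ne_zero (Nat.ne_zero_of_lt hjl)
    have hi : i < k := Nat.lt_of_succ_lt_succ hl
    cases j with
    | zero =>
      simp only [runningMin.eq_1, min_eq_right (h.levelPlacement_mem_Icc _ _).2]
      exact h.sum_runningMin_one_lt.trans_le (h.half_le_sum_levelPlacement_succ hi)
    | succ j => exact h.sum_runningMin_lt_later hi (Nat.lt_of_succ_lt_succ hjl)
  sum_lt_filler j hj := by
    cases j with
    | zero => exact h.sum_runningMin_one_lt.trans_eq (by norm_num [runningMin, div_eq_mul_inv])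
    | succ j => exact h.sum_runningMin_lt_filler (Nat.lt_of_succ_lt_succ hj)

theorem greedyExceeds (h : IsSchedule η q N k t) {B : ℝ}
    (hB : B * -Real.log (q ^ N) < (k + 2) * (η * (1 - q ^ N) * q ^ t k)) : GreedyExceeds B := by
  have : Nonempty (Fin N) := ⟨⟨0, h.period_pos⟩⟩
  have hq := h.ratio_mem.1
  have hN : (0 : ℝ) < N := Nat.cast_pos.2 h.period_pos
  have hgap := sub_pos.2 h.ratio_mem.2
  have hlog : N * (1 - q) ≤ -Real.log (q ^ N) := by
    rw [Real.log_pow, ← mul_neg]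
    gcongr
    linarith [Real.log_le_sub_one_of_pos hq]
  have hmean : η * (1 - q ^ N) * q ^ t k / -Real.log (q ^ N) ≤
      (∑ θ, runningMin 1 (levelPlacement η q N t) (k + 1) θ) / N := by
    rw [← h.one_sub_mul_sum_runningMin_succ le_rfl,
      div_le_div_iff₀ ((mul_pos hN hgap).trans_le hlog) hN]
    have hsum : 0 ≤ ∑ θ, runningMin 1 (levelPlacement η q N t) (k + 1) θ := by
      simp only [h.runningMin_succ le_rfl]
      exact Finset.sum_nonneg fun θ _ => (h.mul_pow_mem_Ioo _).1.le
    linear_combination (∑ θ, runningMin 1 (levelPlacement η q N t) (k + 1) θ) * hlog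
  refine h.isGreedyOrder.greedyExceeds ?_
  calc B < (k + 2) * (η * (1 - q ^ N) * q ^ t k) / -Real.log (q ^ N) :=
        (lt_div_iff₀ ((mul_pos hN hgap).trans_le hlog)).2 hB
    _ = (k + 2) * (η * (1 - q ^ N) * q ^ t k / -Real.log (q ^ N)) := mul_div_assoc _ _ _
    _ ≤ (k + 2) * ((∑ θ, runningMin 1 (levelPlacement η q N t) (k + 1) θ) /
          Fintype.card (Fin N)) := by
        rw [Fintype.card_fin]
        gcongr

end IsSchedule

/-! ### Harmonic schedules -/

/-- The limit of `q ^ t i` along the schedules below. It solves `y i - y (i + 1) = δ y i y (i + 1)`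
with `y 0 = 1`, which makes the drops proportional to `y i ^ 2` up to a factor `1 + δ`, as
`IsSchedule.filler_lt` requires. -/
noncomputable def harmonicLevel (δ : ℝ) (i : ℕ) : ℝ := (1 + δ * i)⁻¹

section HarmonicLevel

variable {δ : ℝ} {i : ℕ}

theorem harmonicLevel_pos (hδ : 0 ≤ δ) : 0 < harmonicLevel δ i := by
  unfold harmonicLevel
  positivity

theorem harmonicLevel_strictAnti (hδ : 0 < δ) : StrictAnti (harmonicLevel δ) := fun i j hij => by
  unfold harmonicLevel
  gcongr

theorem harmonicLevel_le_one (hδ : 0 ≤ δ) : harmonicLevel δ i ≤ 1 :=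
  inv_le_one_of_one_le₀ (le_add_of_nonneg_right (by positivity))

theorem harmonicLevel_sub_succ (hδ : 0 ≤ δ) :
    harmonicLevel δ i - harmonicLevel δ (i + 1) =
      δ * harmonicLevel δ i * harmonicLevel δ (i + 1) := by
  have : 0 < 1 + δ * i := by positivity
  have : 0 < 1 + δ * ((i + 1 : ℕ) : ℝ) := by positivity
  unfold harmonicLevel
  field_simp
  push_cast
  ring

theorem harmonicLevel_le_mul_succ (hδ : 0 ≤ δ) :
    harmonicLevel δ i ≤ (1 + δ) * harmonicLevel δ (i + 1) := by
  have hsub := harmonicLevel_sub_succ (i := i) hδ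
  have hle := mul_le_mul_of_nonneg_left (harmonicLevel_le_one (i := i) hδ)
    (mul_nonneg hδ (harmonicLevel_pos (i := i + 1) hδ).le)
  linarith

theorem mul_sq_harmonicLevel_lt {p : ℝ} (hδ : 0 ≤ δ) (hp : 0 < p) (hpδ : p * (1 + δ) ^ 2 < 1) :
    p * harmonicLevel δ i ^ 2 < harmonicLevel δ (i + 1) ^ 2 := by
  have hpos := harmonicLevel_pos (i := i + 1) hδ
  calc p * harmonicLevel δ i ^ 2 ≤ p * ((1 + δ) * harmonicLevel δ (i + 1)) ^ 2 := by
        gcongr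
        · exact (harmonicLevel_pos hδ).le
        · exact harmonicLevel_le_mul_succ hδ
    _ = p * (1 + δ) ^ 2 * harmonicLevel δ (i + 1) ^ 2 := by ring
    _ < harmonicLevel δ (i + 1) ^ 2 := mul_lt_of_lt_one_left (by positivity) hpδ

theorem mul_sq_harmonicLevel_lt_sub {c d : ℝ} (hδ : 0 ≤ δ) (hc : 0 ≤ c)
    (hcd : c * (1 + δ) < d * δ) :
    c * harmonicLevel δ i ^ 2 < d * (harmonicLevel δ i - harmonicLevel δ (i + 1)) := by
  have hi := harmonicLevel_pos (i := i) hδ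
  have hi' := harmonicLevel_pos (i := i + 1) hδ
  calc c * harmonicLevel δ i ^ 2
      = c * harmonicLevel δ i * harmonicLevel δ i := by ring
    _ ≤ c * harmonicLevel δ i * ((1 + δ) * harmonicLevel δ (i + 1)) := by
        gcongr
        exact harmonicLevel_le_mul_succ hδ
    _ = c * (1 + δ) * (harmonicLevel δ i * harmonicLevel δ (i + 1)) := by ring
    _ < d * δ * (harmonicLevel δ i * harmonicLevel δ (i + 1)) := by gcongr
    _ = d * (harmonicLevel δ i - harmonicLevel δ (i + 1)) := by
        rw [harmonicLevel_sub_succ hδ]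
        ring

theorem harmonicLevel_sub_succ_strictAnti (hδ : 0 < δ) :
    StrictAnti fun i => harmonicLevel δ i - harmonicLevel δ (i + 1) := fun j i hji => by
  simp only [harmonicLevel_sub_succ hδ.le]
  have hi := harmonicLevel_pos (i := i) hδ.le
  have hi' := harmonicLevel_pos (i := i + 1) hδ.le
  have hlt := harmonicLevel_strictAnti hδ hji
  have hlt' := harmonicLevel_strictAnti hδ (Nat.succ_lt_succ hji)
  gcongr

theorem mul_sub_harmonicLevel_mul_sq_lt {c : ℝ} (hδ : 0 < δ) (hc : 0 ≤ c)
    (hcδ : c * (1 + δ) ^ 2 < 1) (i j : ℕ) :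
    c * (harmonicLevel δ i - harmonicLevel δ (i + 1)) * harmonicLevel δ j ^ 2 <
      (harmonicLevel δ j - harmonicLevel δ (j + 1)) * harmonicLevel δ (i + 1) ^ 2 := by
  have hi' := harmonicLevel_pos (i := i + 1) hδ.le
  have hj := harmonicLevel_pos (i := j) hδ.le
  have hj' := harmonicLevel_pos (i := j + 1) hδ.le
  rw [harmonicLevel_sub_succ hδ.le, harmonicLevel_sub_succ hδ.le]
  calc c * (δ * harmonicLevel δ i * harmonicLevel δ (i + 1)) * harmonicLevel δ j ^ 2
      = c * δ * harmonicLevel δ (i + 1) * harmonicLevel δ j *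
          (harmonicLevel δ i * harmonicLevel δ j) := by ring
    _ ≤ c * δ * harmonicLevel δ (i + 1) * harmonicLevel δ j *
          (((1 + δ) * harmonicLevel δ (i + 1)) * ((1 + δ) * harmonicLevel δ (j + 1))) := by
        gcongr <;> exact harmonicLevel_le_mul_succ hδ.le
    _ = c * (1 + δ) ^ 2 *
          (δ * harmonicLevel δ j * harmonicLevel δ (j + 1) * harmonicLevel δ (i + 1) ^ 2) := by
        ring
    _ < δ * harmonicLevel δ j * harmonicLevel δ (j + 1) * harmonicLevel δ (i + 1) ^ 2 :=
        mul_lt_of_lt_one_left (by positivity) hcδ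

end HarmonicLevel

/-- The cursor positions `t i` with `q ^ t i` close to `harmonicLevel δ i`, where `q ^ N = p`. -/
noncomputable def harmonicCursor (δ p : ℝ) (N i : ℕ) : ℕ :=
  ⌈Real.logb p (harmonicLevel δ i) * N⌉₊

theorem tendsto_rpow_inv_natCast {p : ℝ} (hp : 0 < p) :
    Tendsto (fun N : ℕ => p ^ ((N : ℝ)⁻¹)) atTop (𝓝 1) := by
  simpa [Function.comp_def] using (Real.continuous_const_rpow hp.ne').continuousAt.tendsto.comp
    (tendsto_inv_atTop_nhds_zero_nat (𝕜 := ℝ))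

theorem tendsto_rpow_inv_pow_ceil {p a : ℝ} (hp : 0 < p) (ha : 0 ≤ a) :
    Tendsto (fun N : ℕ => (p ^ ((N : ℝ)⁻¹)) ^ ⌈a * N⌉₊) atTop (𝓝 (p ^ a)) := by
  have hceil := (tendsto_nat_ceil_mul_div_atTop ha).comp
    (tendsto_natCast_atTop_atTop (R := ℝ))
  refine ((Real.continuous_const_rpow hp.ne').continuousAt.tendsto.comp hceil).congr fun N => ?_
  simp only [Function.comp_apply]
  rw [← Real.rpow_natCast, ← Real.rpow_mul hp.le, mul_comm, div_eq_mul_inv, mul_comm]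

section HarmonicCursor

variable {δ p : ℝ}

theorem logb_harmonicLevel_nonneg (hδ : 0 ≤ δ) (hp : 0 < p) (hp1 : p < 1) (i : ℕ) :
    0 ≤ Real.logb p (harmonicLevel δ i) :=
  Real.logb_nonneg_of_base_lt_one hp hp1 (harmonicLevel_pos hδ) (harmonicLevel_le_one hδ)

theorem tendsto_pow_harmonicCursor (hδ : 0 ≤ δ) (hp : 0 < p) (hp1 : p < 1) (i : ℕ) :
    Tendsto (fun N : ℕ => (p ^ ((N : ℝ)⁻¹)) ^ harmonicCursor δ p N i) atTop
      (𝓝 (harmonicLevel δ i)) := by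
  have hlim := tendsto_rpow_inv_pow_ceil hp (logb_harmonicLevel_nonneg hδ hp hp1 i)
  rwa [Real.rpow_logb hp hp1.ne (harmonicLevel_pos hδ)] at hlim

theorem harmonicCursor_zero (N : ℕ) : harmonicCursor δ p N 0 = 0 := by
  simp [harmonicCursor, harmonicLevel]

theorem harmonicCursor_monotone (hδ : 0 < δ) (hp : 0 < p) (hp1 : p < 1) (N : ℕ) :
    Monotone (harmonicCursor δ p N) := fun i j hij => by
  have hlog : Real.logb p (harmonicLevel δ i) ≤ Real.logb p (harmonicLevel δ j) :=
    (Real.logb_le_logb_of_base_lt_one hp hp1 (harmonicLevel_pos hδ.le)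
      (harmonicLevel_pos hδ.le)).2 ((harmonicLevel_strictAnti hδ).antitone hij)
  unfold harmonicCursor
  gcongr

theorem two_mul_lt_of_pow_mul_sq_lt {q : ℝ} (hq : 0 < q) (hq1 : q < 1) {N a b : ℕ}
    (h : q ^ N * (q ^ a) ^ 2 < (q ^ b) ^ 2) : 2 * b < 2 * a + N := by
  rw [← pow_mul, ← pow_mul, ← pow_add, pow_lt_pow_iff_right_of_lt_one₀ hq hq1] at h
  omega

theorem eventually_isSchedule {η : ℝ} (hη : η ∈ Set.Ioo 0 (1 / 2)) (hδ : 0 < δ) (hp : 0 < p)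
    (hηδ : η * (1 + p) * (1 + δ) < 4 * δ) (hpδ : p * (1 + p) * (1 + δ) ^ 2 < 1) (k : ℕ) :
    ∀ᶠ N : ℕ in atTop, IsSchedule η (p ^ ((N : ℝ)⁻¹)) N k (harmonicCursor δ p N) := by
  have hpp : p * (1 + p) < 1 := (le_mul_of_one_le_right (by positivity)
    (one_le_pow₀ (by linarith))).trans_lt hpδ
  have hp1 : p < 1 := by nlinarith
  have hlim := tendsto_pow_harmonicCursor hδ.le hp hp1
  have hdrop (i : ℕ) := (hlim i).sub (hlim (i + 1))
  have hratio := tendsto_rpow_inv_natCast hp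
  have htwo : ∀ᶠ N : ℕ in atTop, ∀ i < k, p * ((p ^ ((N : ℝ)⁻¹)) ^ harmonicCursor δ p N i) ^ 2 <
      ((p ^ ((N : ℝ)⁻¹)) ^ harmonicCursor δ p N (i + 1)) ^ 2 :=
    eventually_forall_lt fun i _ => (((hlim i).pow 2).const_mul p).eventually_lt
      ((hlim (i + 1)).pow 2) (mul_sq_harmonicLevel_lt hδ.le hp (by nlinarith))
  have hfiller := eventually_forall_lt (k := k) fun i _ =>
    (((hlim i).pow 2).const_mul (η * (1 + p))).eventually_lt
      (((hratio.const_add 1).const_mul 2).mul (hdrop i))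
      (mul_sq_harmonicLevel_lt_sub hδ.le (by have := hη.1; positivity) (by linarith))
  have hlater := eventually_forall_lt (k := k) fun i _ => eventually_forall_lt fun j hj =>
    (hdrop i).eventually_lt (hdrop j) (harmonicLevel_sub_succ_strictAnti hδ hj)
  have hearly := eventually_forall_lt (k := k) fun i _ => eventually_forall_lt (k := i) fun j _ =>
    (((hdrop i).const_mul (p * (1 + p))).mul ((hlim j).pow 2)).eventually_lt
      ((hdrop j).mul ((hlim (i + 1)).pow 2))
      (mul_sub_harmonicLevel_mul_sq_lt hδ (by positivity) hpδ i j)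
  filter_upwards [eventually_ne_atTop 0, htwo, hfiller, hlater, hearly] with N hN htwo hfiller
    hlater hearly
  have hperiod : (p ^ ((N : ℝ)⁻¹)) ^ N = p := Real.rpow_inv_natCast_pow hp.le hN
  have hq : 0 < p ^ ((N : ℝ)⁻¹) := Real.rpow_pos_of_pos hp _
  have hq1 : p ^ ((N : ℝ)⁻¹) < 1 := Real.rpow_lt_one hp.le hp1 (by positivity)
  refine ⟨hη, ⟨hq, hq1⟩, Nat.pos_of_ne_zero hN, ?_, harmonicCursor_zero N,
    harmonicCursor_monotone hδ hp hp1 N, fun i hi => ?_, ?_, hlater, ?_⟩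
  · rwa [hperiod]
  · exact (two_mul_lt_of_pow_mul_sq_lt hq hq1 (by rw [hperiod]; exact htwo i hi)).le
  · rwa [hperiod]
  · rwa [hperiod]

end HarmonicCursor

theorem exists_lt_mul_harmonicLevel {a c δ : ℝ} (hδ : 0 ≤ δ) (hac : a * δ < c) :
    ∃ k : ℕ, a < (k + 2) * (c * harmonicLevel δ k) := by
  obtain ⟨k, hk⟩ := exists_nat_gt ((a - 2 * c) / (c - a * δ))
  refine ⟨k, ?_⟩
  rw [div_lt_iff₀ (sub_pos.2 hac)] at hk
  rw [harmonicLevel, ← mul_assoc, ← div_eq_mul_inv, lt_div_iff₀ (by positivity)]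
  linear_combination hk

theorem exists_pos_mul_sq_lt {p a : ℝ} (hpp : p * (1 + p) < 1)
    (ha : a * (1 + p) < 4 * (1 - p)) :
    ∃ δ > 0, δ < 1 / 8 ∧ p * (1 + p) * (1 + δ) ^ 2 < 1 ∧
      a * (1 + p) * (1 + δ) ^ 2 < 4 * (1 - p) := by
  have hlim (c : ℝ) : Tendsto (fun δ : ℝ => c * (1 + δ) ^ 2) (𝓝[>] 0) (𝓝 c) :=
    tendsto_nhdsWithin_of_tendsto_nhds <|
      Continuous.tendsto' (by fun_prop) _ _ (by norm_num)
  have hsmall : ∀ᶠ δ : ℝ in 𝓝[>] 0, δ < 1 / 8 :=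
    eventually_nhdsWithin_of_eventually_nhds (eventually_lt_nhds (by norm_num))
  exact (eventually_mem_nhdsWithin.and (hsmall.and
    (((hlim _).eventually_lt_const hpp).and ((hlim _).eventually_lt_const ha)))).exists

theorem greedyExceeds_of_mul_log_lt {B p : ℝ} (hp : 0 < p) (hpp : p * (1 + p) < 1)
    (hB : B * -Real.log p * (1 + p) < 4 * (1 - p)) : GreedyExceeds B := by
  obtain ⟨δ, hδ, hδ8, hpδ, hBδ⟩ := exists_pos_mul_sq_lt hpp hB
  have hp1 : p < 1 := by nlinarith
  have hden : 0 < (1 + p) * (1 + δ) ^ 2 := by positivity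
  set η := 4 * δ / ((1 + p) * (1 + δ) ^ 2) with hη
  have hηden : η * ((1 + p) * (1 + δ) ^ 2) = 4 * δ := div_mul_cancel₀ _ hden.ne'
  have hη0 : 0 < η := by positivity
  have hη_half : η < 1 / 2 := by
    rw [hη, div_lt_iff₀ hden]
    nlinarith
  have hηδ : η * (1 + p) * (1 + δ) < 4 * δ := by
    rw [← hηden]
    nlinarith [mul_pos (mul_pos hη0 (show 0 < 1 + p by linarith)) hδ]
  have hgrowth : B * -Real.log p * δ < η * (1 - p) := by
    rw [hη, div_mul_eq_mul_div, lt_div_iff₀ hden]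
    nlinarith
  obtain ⟨k, hk⟩ := exists_lt_mul_harmonicLevel hδ.le hgrowth
  have hlim := ((tendsto_pow_harmonicCursor hδ.le hp hp1 k).const_mul
    (η * (1 - p))).const_mul ((k : ℝ) + 2)
  obtain ⟨N, hN, hschedule, hgain⟩ := ((eventually_ne_atTop 0).and
    ((eventually_isSchedule ⟨hη0, hη_half⟩ hδ hp hηδ hpδ k).and
      (hlim.eventually_const_lt hk))).exists
  refine hschedule.greedyExceeds ?_
  rwa [Real.rpow_inv_natCast_pow hp.le hN]

theorem one_sub_inv_of_sq_eq_add_one {K : Type*} [Field K] {x : K} (hx : x ^ 2 = x + 1) :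
    1 - x⁻¹ = (x ^ 2)⁻¹ := by
  have hx0 : x ≠ 0 := by
    rintro rfl
    simp at hx
  field_simp
  linear_combination hx

theorem mainTheorem6_general {B : ℝ}
    (hB : B < 4 / (Real.goldenRatio ^ 3 * Real.log Real.goldenRatio)) : GreedyExceeds B := by
  have hφ : 0 < Real.goldenRatio := Real.goldenRatio_pos
  have hinv : 1 + Real.goldenRatio⁻¹ = Real.goldenRatio := by
    rw [Real.inv_goldenRatio, ← sub_eq_add_neg, Real.one_sub_goldenRatio]
  have hcritical : B * -Real.log Real.goldenRatio⁻¹ * (1 + Real.goldenRatio⁻¹) <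
      4 * (1 - Real.goldenRatio⁻¹) := by
    have hlog := Real.log_pos Real.one_lt_goldenRatio
    rw [lt_div_iff₀ (by positivity)] at hB
    rw [hinv, one_sub_inv_of_sq_eq_add_one Real.goldenRatio_sq, Real.log_inv, neg_neg,
      ← div_eq_mul_inv, lt_div_iff₀ (by positivity)]
    linear_combination hB
  have hnear : ∀ᶠ p in 𝓝[<] Real.goldenRatio⁻¹, B * -Real.log p * (1 + p) < 4 * (1 - p) := by
    have hlog := (Real.continuousAt_log (inv_pos.2 hφ).ne').neg
    exact eventually_nhdsWithin_of_eventually_nhds <|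
      ((continuousAt_const.mul hlog).mul (by fun_prop)).eventually_lt (by fun_prop) hcritical
  obtain ⟨p, hB, hp, hpφ⟩ := (hnear.and (Ioo_mem_nhdsLT (inv_pos.2 hφ))).exists
  refine greedyExceeds_of_mul_log_lt hp ?_ hB
  calc p * (1 + p) < Real.goldenRatio⁻¹ * (1 + Real.goldenRatio⁻¹) := by gcongr
    _ = 1 := by rw [hinv, inv_mul_cancel₀ hφ.ne']

theorem lt_four_div_goldenRatio_pow_three_mul_log :
    1.962 < 4 / (Real.goldenRatio ^ 3 * Real.log Real.goldenRatio) := by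
  have hφ : 1 < Real.goldenRatio := Real.one_lt_goldenRatio
  have hφ_lt : Real.goldenRatio < 1.618034 := by
    have : √5 < 2.236068 := (Real.sqrt_lt' (by norm_num)).2 (by norm_num)
    rw [Real.goldenRatio]
    linarith
  have hlog := Real.log_pos hφ
  have hlog_lt : Real.log Real.goldenRatio < 0.48122 := by
    rw [Real.log_lt_iff_lt_exp (by positivity)]
    refine hφ_lt.trans (lt_of_lt_of_le ?_
      (Real.sum_le_exp_of_nonneg (x := 0.48122) (by norm_num) 9))
    norm_num [Finset.sum_range_succ, Nat.factorial]
  rw [lt_div_iff₀ (by positivity)]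
  calc 1.962 * (Real.goldenRatio ^ 3 * Real.log Real.goldenRatio)
      < 1.962 * (1.618034 ^ 3 * 0.48122) := by gcongr
    _ < 4 := by norm_num

theorem mainTheorem6 :
    ∃ (V C : Type) (_ : Fintype V) (_ : Nonempty V) (_ : Fintype C) (_ : DecidableEq C)
      (E : Election V C) (k : ℕ),
      1 ≤ k ∧ k ≤ Fintype.card C ∧
        ∀ T : Finset C, E.IsGreedyCommittee k T →
          E.score T > 1.962 * (((Fintype.card C : ℝ) + 1) / ((k : ℝ) + 1)) :=
  mainTheorem6_general lt_four_div_goldenRatio_pow_three_mul_log
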